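/- Let $k$ be a field, $G$ a group, and $M=\bigoplus_{g\in G}M_g$ a Yetter–Drinfel'd module over $G$, i.e. a $G$-graded $k$-vector space with a linear $G$-action such that $g.M_h=M_{ghg^{-1}}$. For a basis $(x_i)$ of $M$ with $x_i\in M_{g_i}$ let $\partial_i$ be the skew derivations of the tensor algebra $T(M)$ given by $\partial_i(1)=0$, $\partial_i(x_j)=\delta_{ij}$, $\partial_i(ab)=\partial_i(a)b+(g_i.a)\partial_i(b)$. The Nichols algebra $\mathfrak B(M)=T(M)/\mathfrak I$ is the quotient by the largest proper homogeneous two-sided ideal $\mathfrak I$ that is stable under all $\partial_i$ and satisfies $M\cap\mathfrak I=0$. It is $\mathbb N$-graded, $\mathfrak B(M)=\bigoplus_n\mathfrak B(M)_n$, with projections $P_n$ onto the layers, and it has the augmentation $\varepsilon:\mathfrak B(M)\to k$ with $\varepsilon(M)=0$. Assume that $\mathfrak B(M)$ is finite-dimensional. Let $L$ be its top degree (the largest $n$ with $\mathfrak B(M)_n\neq 0$) and let $\Lambda\ne0$ be an integral, i.e. a nonzero element with $x\Lambda=\varepsilon(x)\Lambda$ for all $x$, or with $\Lambda x=\varepsilon(x)\Lambda$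 for all $x$. For a linear operator $Q$ on $\mathfrak B(M)$ let $\operatorname{tr}_Q(t)=\operatorname{tr}(t^EQ)=\sum_{n\ge0}t^n\operatorname{tr}(P_nQ)\in k[t]$ be its graded trace; if $Q$ preserves the layers, $\operatorname{tr}(P_nQ)$ is the trace of $Q|_{\mathfrak B(M)_n}$. (1) For every $k$-algebra automorphism $Q$ of $\mathfrak B(M)$ (not necessarily graded) there is a unique scalar $\lambda_Q\in k^\times$ with $Q\Lambda=\lambda_Q\Lambda$, and $$\operatorname{tr}(Q)=\lambda_Q\,\operatorname{tr}(Q^{-1}),\qquad \operatorname{tr}_Q(t)=\lambda_Q\,t^L\,\operatorname{tr}_{Q^{-1}}(t^{-1})\quad\text{in } k[t,t^{-1}].$$ (2) The Hilbert series $H(t)=\sum_n\dim(\mathfrak B(M)_n)\,t^n\in\mathbb Z[t]$ satisfies the Poincaré duality $H(t)=t^L\,H(t^{-1})$ in $\mathbb Z[t,t^{-1}]$. -/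

import Mathlib

open scoped DirectSum

/-- A Yetter–Drinfel'd module structure over the group `G` on the `k`-vector space `M`:
a linear `G`-action together with a `G`-grading `M = ⨁ g, M_g` such that
`g . M_h = M_{g h g⁻¹}`. -/
structure YetterDrinfeldModule (k G M : Type*) [Field k] [Group G]
    [AddCommGroup M] [Module k M] where
  /-- the action of `G` -/
  ρ : Representation k G M
  /-- the layers `M_g` of the `G`-grading -/
  layer : G → Submodule k M
  iSupIndep_layer : iSupIndep layer
  iSup_layer : ⨆ g, layer g = ⊤
  map_layer : ∀ g h : G, (layer h).map (ρ g) = layer (g * h * g⁻¹)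

namespace YetterDrinfeldModule

variable {k G M : Type*} [Field k] [Group G] [AddCommGroup M] [Module k M]

/-- The diagonal action of `g : G` on the tensor algebra of `M`, by algebra endomorphisms. -/
def tensorAct (D : YetterDrinfeldModule k G M) (g : G) :
    TensorAlgebra k M →ₐ[k] TensorAlgebra k M :=
  TensorAlgebra.lift k ((TensorAlgebra.ι k) ∘ₗ (D.ρ g))

/-- The algebra homomorphism from the tensor algebra to the `2 × 2` matrices over it which
sends `v : M` to `(g.v, f v; 0, v)`. It is `a ↦ (g.a, ∂ a; 0, a)` with `∂` the skew derivation
attached to `g` and `f`. -/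
noncomputable def skewMatrix (D : YetterDrinfeldModule k G M) (g : G) (f : Module.Dual k M) :
    TensorAlgebra k M →ₐ[k] Matrix (Fin 2) (Fin 2) (TensorAlgebra k M) :=
  TensorAlgebra.lift k
    { toFun := fun v =>
        !![TensorAlgebra.ι k (D.ρ g v), algebraMap k (TensorAlgebra k M) (f v);
          0, TensorAlgebra.ι k v]
      map_add' := fun v w => by
        ext i j; fin_cases i <;> fin_cases j <;> simp
      map_smul' := fun c v => by
        ext i j; fin_cases i <;> fin_cases j <;> simp [Algebra.smul_def] }

/-- The skew derivation `∂` of the tensor algebra attached to `g : G` and a linear form `f`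
on `M`: the linear map with `∂ 1 = 0`, `∂ v = f v` for `v` in `M`, and
`∂ (a b) = ∂ a * b + (g.a) * ∂ b`. When `x_i` is a basis of `M` consisting of homogeneous
vectors, `x_i` in `M_{g_i}`, the skew derivation `∂_i` is the one attached to `g_i` and to the
`i`-th coordinate form. -/
noncomputable def skewDer (D : YetterDrinfeldModule k G M) (g : G) (f : Module.Dual k M) :
    TensorAlgebra k M →ₗ[k] TensorAlgebra k M :=
  (Matrix.entryLinearMap k (TensorAlgebra k M) (0 : Fin 2) (1 : Fin 2)) ∘ₗ
    (D.skewMatrix g f).toLinearMap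

theorem skewDer_one (D : YetterDrinfeldModule k G M) (g : G) (f : Module.Dual k M) :
    D.skewDer g f 1 = 0 := by
  simp [skewDer]

theorem skewDer_ι (D : YetterDrinfeldModule k G M) (g : G) (f : Module.Dual k M) (v : M) :
    D.skewDer g f (TensorAlgebra.ι k v) = algebraMap k (TensorAlgebra k M) (f v) := by
  simp [skewDer, skewMatrix]

theorem skewMatrix_eq (D : YetterDrinfeldModule k G M) (g : G) (f : Module.Dual k M)
    (a : TensorAlgebra k M) :
    D.skewMatrix g f a = !![D.tensorAct g a, D.skewDer g f a; 0, a] := by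
  induction a using TensorAlgebra.induction with
  | algebraMap r =>
    ext i j
    fin_cases i <;> fin_cases j <;> simp [skewDer, Matrix.algebraMap_matrix_apply]
  | ι v =>
    ext i j
    fin_cases i <;> fin_cases j <;> simp [skewDer, skewMatrix, tensorAct]
  | mul a b ha hb =>
    have h : D.skewMatrix g f (a * b) = D.skewMatrix g f a * D.skewMatrix g f b := map_mul _ _ _
    have h2 : D.skewDer g f (a * b) = D.skewMatrix g f (a * b) 0 1 := rfl
    rw [h2, h, ha, hb]
    ext i j
    fin_cases i <;> fin_cases j <;> simp [Matrix.mul_apply]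
  | add a b ha hb =>
    rw [map_add, ha, hb, map_add, map_add]
    ext i j
    fin_cases i <;> fin_cases j <;> simp

theorem skewDer_mul (D : YetterDrinfeldModule k G M) (g : G) (f : Module.Dual k M)
    (a b : TensorAlgebra k M) :
    D.skewDer g f (a * b) = D.skewDer g f a * b + D.tensorAct g a * D.skewDer g f b := by
  have h : D.skewDer g f (a * b) = (D.skewMatrix g f a * D.skewMatrix g f b) 0 1 := by
    rw [← map_mul]; rfl
  rw [h, skewMatrix_eq, skewMatrix_eq]
  simp [Matrix.mul_apply, add_comm]

variable (k M) in
/-- The homogeneous component of degree `n` of the tensor algebra. -/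
abbrev tensorLayer (n : ℕ) : Submodule k (TensorAlgebra k M) :=
  LinearMap.range (TensorAlgebra.ι k : M →ₗ[k] TensorAlgebra k M) ^ n

/-- The ideals competing in the definition of the Nichols algebra: proper homogeneous two-sided
ideals `I` of the tensor algebra with `M ∩ I = 0` that are stable under all skew derivations
attached to `g` in `G` and a linear form on `M` supported on the layer `M_g`. (Properness is
automatic unless `M = 0`.) -/
structure IsNicholsAdmissible (D : YetterDrinfeldModule k G M)
    (I : Ideal (TensorAlgebra k M)) : Prop where
  isTwoSided : I.IsTwoSided
  ne_top : I ≠ ⊤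
  isHomogeneous : I.IsHomogeneous (tensorLayer k M)
  skewDer_mem : ∀ (g : G) (f : Module.Dual k M),
    (∀ h : G, h ≠ g → ∀ v ∈ D.layer h, f v = 0) → ∀ a ∈ I, D.skewDer g f a ∈ I
  inf_eq_bot : ∀ v : M, TensorAlgebra.ι k v ∈ I → v = 0

/-- The largest admissible ideal. -/
noncomputable def nicholsIdeal (D : YetterDrinfeldModule k G M) : Ideal (TensorAlgebra k M) :=
  sSup {I | D.IsNicholsAdmissible I}

theorem proj_zero_eq (a : TensorAlgebra k M) :
    GradedAlgebra.proj (tensorLayer k M) 0 a =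
      algebraMap k (TensorAlgebra k M) (TensorAlgebra.algebraMapInv a) := by
  have key : ∀ n, ∀ x ∈ tensorLayer k M n, n ≠ 0 → TensorAlgebra.algebraMapInv x = 0 := by
    intro n x hx hn
    obtain ⟨m, rfl⟩ := Nat.exists_eq_succ_of_ne_zero hn
    rw [tensorLayer, pow_succ] at hx
    induction hx using Submodule.mul_induction_on' with
    | mem_mul_mem a ha b hb =>
      obtain ⟨v, rfl⟩ := hb
      simp [TensorAlgebra.algebraMapInv]
    | add a ha b hb h1 h2 => rw [map_add, h1, h2, add_zero]
  induction a using DirectSum.Decomposition.inductionOn (tensorLayer k M) with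
  | zero => simp
  | @homogeneous i m =>
    by_cases hi : i = 0
    · subst hi
      obtain ⟨m, hm⟩ := m
      rw [GradedAlgebra.proj_apply, DirectSum.decompose_of_mem_same _ hm]
      rw [tensorLayer, pow_zero] at hm
      obtain ⟨c, hc⟩ := Submodule.mem_one.1 hm
      simp only [← hc, AlgHom.commutes]
      rfl
    · rw [GradedAlgebra.proj_apply, DirectSum.decompose_of_mem_ne _ m.2 hi, key i _ m.2 hi,
        map_zero]
  | add a b ha hb => rw [map_add, ha, hb, map_add, map_add]

theorem IsNicholsAdmissible.algebraMapInv_eq_zero {D : YetterDrinfeldModule k G M}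
    {I : Ideal (TensorAlgebra k M)} (hI : D.IsNicholsAdmissible I)
    {a : TensorAlgebra k M} (ha : a ∈ I) : TensorAlgebra.algebraMapInv a = 0 := by
  by_contra hne
  apply hI.ne_top
  have h0 : GradedAlgebra.proj (tensorLayer k M) 0 a ∈ I := hI.isHomogeneous 0 ha
  rw [proj_zero_eq] at h0
  exact Ideal.eq_top_of_isUnit_mem _ h0 ((isUnit_iff_ne_zero.2 hne).map _)

theorem IsNicholsAdmissible.proj_one_eq_zero {D : YetterDrinfeldModule k G M}
    {I : Ideal (TensorAlgebra k M)} (hI : D.IsNicholsAdmissible I)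
    {a : TensorAlgebra k M} (ha : a ∈ I) : GradedAlgebra.proj (tensorLayer k M) 1 a = 0 := by
  have h1 : GradedAlgebra.proj (tensorLayer k M) 1 a ∈ I := hI.isHomogeneous 1 ha
  have h2 : GradedAlgebra.proj (tensorLayer k M) 1 a ∈ tensorLayer k M 1 := by
    rw [GradedAlgebra.proj_apply]; exact SetLike.coe_mem _
  rw [tensorLayer, pow_one] at h2
  obtain ⟨v, hv⟩ := h2
  rw [← hv] at h1 ⊢
  rw [hI.inf_eq_bot v h1, map_zero]

theorem isNicholsAdmissible_bot (D : YetterDrinfeldModule k G M) :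
    D.IsNicholsAdmissible ⊥ where
  isTwoSided := inferInstance
  ne_top := bot_ne_top
  isHomogeneous := Ideal.IsHomogeneous.bot _
  skewDer_mem := fun g f _ a ha => by
    rw [Ideal.mem_bot] at ha ⊢
    rw [ha, map_zero]
  inf_eq_bot := fun v hv => by
    rw [Ideal.mem_bot] at hv
    exact TensorAlgebra.ι_leftInverse.injective (by rw [hv, map_zero])

/-- `nicholsIdeal` is admissible, and by definition it contains every admissible ideal. -/
theorem isGreatest_nicholsIdeal (D : YetterDrinfeldModule k G M) :
    IsGreatest {I | D.IsNicholsAdmissible I} D.nicholsIdeal := by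
  have ind : ∀ (p : TensorAlgebra k M → Prop), p 0 → (∀ a b, p a → p b → p (a + b)) →
      (∀ I, D.IsNicholsAdmissible I → ∀ a ∈ I, p a) → ∀ a ∈ D.nicholsIdeal, p a := by
    intro p h0 hadd hmem a ha
    rw [nicholsIdeal, sSup_eq_iSup'] at ha
    exact Submodule.iSup_induction _ (motive := p) ha (fun I x hx => hmem I.1 I.2 x hx) h0 hadd
  have hle : ∀ I, D.IsNicholsAdmissible I → I ≤ D.nicholsIdeal := fun I hI => le_sSup hI
  refine ⟨⟨⟨fun {a} b ha => ?_⟩, ?_, ?_, ?_, ?_⟩, fun I hI => hle I hI⟩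
  · refine ind (fun a => a * b ∈ D.nicholsIdeal) (by simp)
      (fun x y hx hy => by rw [add_mul]; exact add_mem hx hy) (fun I hI x hx => ?_) a ha
    exact hle I hI (hI.isTwoSided.mul_mem_of_left b hx)
  · intro htop
    have h1 : (1 : TensorAlgebra k M) ∈ D.nicholsIdeal := htop ▸ Submodule.mem_top
    have := ind (fun a => TensorAlgebra.algebraMapInv a = 0) (map_zero _)
      (fun x y hx hy => by rw [map_add, hx, hy, add_zero])
      (fun I hI x hx => hI.algebraMapInv_eq_zero hx) 1 h1
    rw [map_one] at this
    exact one_ne_zero this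
  · exact Ideal.IsHomogeneous.sSup fun I hI => hI.isHomogeneous
  · intro g f hf a ha
    refine ind (fun a => D.skewDer g f a ∈ D.nicholsIdeal) (by simp)
      (fun x y hx hy => by rw [map_add]; exact add_mem hx hy) (fun I hI x hx => ?_) a ha
    exact hle I hI (hI.skewDer_mem g f hf x hx)
  · intro v hv
    have h := ind (fun a => GradedAlgebra.proj (tensorLayer k M) 1 a = 0) (map_zero _)
      (fun x y hx hy => by rw [map_add, hx, hy, add_zero])
      (fun I hI x hx => hI.proj_one_eq_zero hx) _ hv
    have hm : TensorAlgebra.ι k v ∈ tensorLayer k M 1 := by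
      rw [tensorLayer, pow_one]; exact LinearMap.mem_range_self _ v
    rw [GradedAlgebra.proj_apply, DirectSum.decompose_of_mem_same _ hm] at h
    exact TensorAlgebra.ι_leftInverse.injective (by rw [h, map_zero])

instance isTwoSided_nicholsIdeal (D : YetterDrinfeldModule k G M) :
    D.nicholsIdeal.IsTwoSided :=
  D.isGreatest_nicholsIdeal.1.isTwoSided

/-- The Nichols algebra `𝔅(M)`. -/
abbrev NicholsAlgebra (D : YetterDrinfeldModule k G M) : Type _ :=
  TensorAlgebra k M ⧸ D.nicholsIdeal

/-- The quotient map from the tensor algebra onto the Nichols algebra. -/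
noncomputable abbrev nicholsMk (D : YetterDrinfeldModule k G M) :
    TensorAlgebra k M →ₐ[k] D.NicholsAlgebra :=
  Ideal.Quotient.mkₐ k D.nicholsIdeal

/-- The homogeneous component `𝔅(M)_n` of degree `n`. -/
noncomputable def nicholsLayer (D : YetterDrinfeldModule k G M) (n : ℕ) :
    Submodule k D.NicholsAlgebra :=
  (tensorLayer k M n).map D.nicholsMk.toLinearMap

/-- Auxiliary: the map from the tensor algebra to the direct sum of the layers. -/
noncomputable def tensorDecompose (D : YetterDrinfeldModule k G M) :
    TensorAlgebra k M →ₗ[k] ⨁ n, D.nicholsLayer n :=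
  (DirectSum.toModule k ℕ (⨁ n, D.nicholsLayer n) fun n =>
    DirectSum.lof k ℕ (fun n => D.nicholsLayer n) n ∘ₗ
      (D.nicholsMk.toLinearMap.submoduleMap (tensorLayer k M n))) ∘ₗ
    (DirectSum.decomposeLinearEquiv (tensorLayer k M)).toLinearMap

theorem tensorDecompose_of_mem (D : YetterDrinfeldModule k G M) {n : ℕ}
    {a : TensorAlgebra k M} (ha : a ∈ tensorLayer k M n) :
    D.tensorDecompose a = DirectSum.lof k ℕ (fun n => D.nicholsLayer n) n
      ⟨D.nicholsMk a, Submodule.mem_map_of_mem ha⟩ := by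
  have h : DirectSum.decomposeLinearEquiv (tensorLayer k M) a =
      DirectSum.lof k ℕ (fun n => tensorLayer k M n) n ⟨a, ha⟩ :=
    DirectSum.decompose_of_mem _ ha
  rw [tensorDecompose, LinearMap.comp_apply, LinearEquiv.coe_coe, h, DirectSum.toModule_lof]
  rfl

theorem tensorDecompose_apply (D : YetterDrinfeldModule k G M) (a : TensorAlgebra k M) (n : ℕ) :
    (D.tensorDecompose a n : D.NicholsAlgebra) =
      D.nicholsMk (GradedAlgebra.proj (tensorLayer k M) n a) := by
  induction a using DirectSum.Decomposition.inductionOn (tensorLayer k M) with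
  | zero => simp
  | @homogeneous i m =>
    rw [tensorDecompose_of_mem D m.2, GradedAlgebra.proj_apply]
    by_cases hi : i = n
    · subst hi
      rw [DirectSum.decompose_of_mem_same _ m.2]
      simp [DirectSum.lof_apply]
    · rw [DirectSum.decompose_of_mem_ne _ m.2 hi, map_zero, DirectSum.lof_eq_of,
        DirectSum.of_eq_of_ne _ _ _ (Ne.symm hi)]
      rfl
  | add a b ha hb =>
    rw [map_add, DirectSum.add_apply, Submodule.coe_add, ha, hb, map_add, map_add]

theorem tensorDecompose_eq_zero (D : YetterDrinfeldModule k G M) {a : TensorAlgebra k M}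
    (ha : a ∈ D.nicholsIdeal) : D.tensorDecompose a = 0 := by
  refine DFinsupp.ext fun n => Subtype.ext ?_
  rw [tensorDecompose_apply]
  exact Ideal.Quotient.eq_zero_iff_mem.2 (D.isGreatest_nicholsIdeal.1.isHomogeneous n ha)

/-- Auxiliary: the decomposition map of the Nichols algebra. -/
noncomputable def nicholsDecompose (D : YetterDrinfeldModule k G M) :
    D.NicholsAlgebra →+ ⨁ n, D.nicholsLayer n :=
  QuotientAddGroup.lift D.nicholsIdeal.toAddSubgroup D.tensorDecompose.toAddMonoidHom
    fun _ ha => AddMonoidHom.mem_ker.2 (D.tensorDecompose_eq_zero ha)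

theorem nicholsDecompose_mk (D : YetterDrinfeldModule k G M) (a : TensorAlgebra k M) :
    D.nicholsDecompose (D.nicholsMk a) = D.tensorDecompose a := rfl

/-- The Nichols algebra is graded by its layers. -/
noncomputable instance nicholsGradedAlgebra (D : YetterDrinfeldModule k G M) :
    GradedAlgebra D.nicholsLayer where
  one_mem := ⟨1, SetLike.GradedOne.one_mem, map_one D.nicholsMk⟩
  mul_mem := by
    rintro i j _ _ ⟨a, ha, rfl⟩ ⟨b, hb, rfl⟩
    exact ⟨a * b, SetLike.GradedMul.mul_mem ha hb, map_mul D.nicholsMk a b⟩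
  decompose' := D.nicholsDecompose
  left_inv := by
    intro x
    obtain ⟨a, rfl⟩ := Ideal.Quotient.mk_surjective x
    change DirectSum.coeAddMonoidHom D.nicholsLayer (D.tensorDecompose a) = D.nicholsMk a
    induction a using DirectSum.Decomposition.inductionOn (tensorLayer k M) with
    | zero => simp
    | @homogeneous i m =>
      rw [tensorDecompose_of_mem D m.2, DirectSum.lof_eq_of, DirectSum.coeAddMonoidHom_of]
    | add a b ha hb => rw [map_add, map_add, ha, hb, map_add]
  right_inv := by
    intro x
    induction x using DirectSum.induction_on with
    | zero => rw [map_zero, map_zero]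
    | of i x =>
      obtain ⟨_, a, ha, rfl⟩ := x
      rw [DirectSum.coeAddMonoidHom_of]
      exact D.tensorDecompose_of_mem ha
    | add x y hx hy => rw [map_add, map_add, hx, hy]

/-- The augmentation (counit) `ε : 𝔅(M) → k`, which sends `M` to `0`. -/
noncomputable def counit (D : YetterDrinfeldModule k G M) : D.NicholsAlgebra →ₐ[k] k :=
  Ideal.Quotient.liftₐ D.nicholsIdeal TensorAlgebra.algebraMapInv fun _ ha =>
    D.isGreatest_nicholsIdeal.1.algebraMapInv_eq_zero ha

/-- `L` is the top degree of `𝔅(M)`: the largest `n` with `𝔅(M)_n ≠ 0`. -/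
def IsTopDegree (D : YetterDrinfeldModule k G M) (L : ℕ) : Prop :=
  IsGreatest {n | D.nicholsLayer n ≠ ⊥} L

/-- `Λ` is an integral of `𝔅(M)`: a nonzero element that is a left integral, `x Λ = ε(x) Λ`
for all `x`, or a right integral, `Λ x = ε(x) Λ` for all `x`. -/
def IsIntegral (D : YetterDrinfeldModule k G M) (Λ : D.NicholsAlgebra) : Prop :=
  Λ ≠ 0 ∧ ((∀ x, x * Λ = D.counit x • Λ) ∨ (∀ x, Λ * x = D.counit x • Λ))

end YetterDrinfeldModule

section GradedTrace

variable {k V : Type*} [Field k] [AddCommGroup V] [Module k V]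

/-- The projection `P_n` of the graded vector space `V = ⨁ n, V_n` onto its layer `V_n`, as an
operator on `V`. -/
def layerProj (𝒱 : ℕ → Submodule k V) [DirectSum.Decomposition 𝒱] (n : ℕ) : V →ₗ[k] V :=
  (𝒱 n).subtype ∘ₗ DirectSum.component k ℕ (fun i => 𝒱 i) n ∘ₗ
    (DirectSum.decomposeLinearEquiv 𝒱).toLinearMap

/-- The graded trace `tr_Q(t) = tr(t^E Q) = ∑ n, t^n tr(P_n Q)`, a polynomial in `t`, of an
operator `Q` on a finite-dimensional graded vector space, where `t^E = ∑ n, t^n P_n`. When `Q`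
preserves the layers, `tr(P_n Q)` is the trace of `Q` restricted to the `n`-th layer. -/
noncomputable def gradedTrace (𝒱 : ℕ → Submodule k V) [DirectSum.Decomposition 𝒱]
    (Q : V →ₗ[k] V) : Polynomial k :=
  ∑ᶠ n : ℕ, Polynomial.monomial n (LinearMap.trace k V (layerProj 𝒱 n ∘ₗ Q))

/-- The Hilbert series `H(t) = ∑ n, dim(V_n) t^n`, a polynomial with integer coefficients, of a
finite-dimensional graded vector space. -/
noncomputable def hilbertPoly (𝒱 : ℕ → Submodule k V) : Polynomial ℤ :=
  ∑ᶠ n : ℕ, Polynomial.monomial n (Module.finrank k (𝒱 n) : ℤ)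

theorem finite_setOf_layer_ne_bot [FiniteDimensional k V] (𝒱 : ℕ → Submodule k V)
    [DirectSum.Decomposition 𝒱] : {n | 𝒱 n ≠ ⊥}.Finite :=
  WellFoundedGT.finite_ne_bot_of_iSupIndep
    (DirectSum.Decomposition.isInternal 𝒱).submodule_iSupIndep

theorem coeff_finsum_monomial {R : Type*} [Semiring R] (c : ℕ → R)
    (hc : {n | c n ≠ 0}.Finite) (n : ℕ) :
    (∑ᶠ i : ℕ, Polynomial.monomial i (c i)).coeff n = c n := by
  have hsupp : (Function.support fun i : ℕ => Polynomial.monomial i (c i)) ⊆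
      ↑hc.toFinset := by
    intro i hi
    simpa using hi
  rw [finsum_eq_sum_of_support_subset _ hsupp, Polynomial.finsetSum_coeff]
  by_cases hn : c n = 0
  · simp +contextual [Polynomial.coeff_monomial, hn]
  · simp [Polynomial.coeff_monomial, hn]

/-- The coefficients of the graded trace are the numbers `tr(P_n Q)`. -/
theorem coeff_gradedTrace [FiniteDimensional k V] (𝒱 : ℕ → Submodule k V)
    [DirectSum.Decomposition 𝒱] (Q : V →ₗ[k] V) (n : ℕ) :
    (gradedTrace 𝒱 Q).coeff n = LinearMap.trace k V (layerProj 𝒱 n ∘ₗ Q) := by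
  refine coeff_finsum_monomial _ ((finite_setOf_layer_ne_bot 𝒱).subset fun i hi h => hi ?_) n
  have h0 : layerProj 𝒱 i = 0 := by
    ext v
    have h1 : layerProj 𝒱 i v ∈ 𝒱 i := ((DirectSum.decompose 𝒱 v) i).2
    rw [h, Submodule.mem_bot] at h1
    exact h1
  rw [h0, LinearMap.zero_comp, map_zero]

/-- For an operator preserving the layers, the coefficients of the graded trace are the traces
of its restrictions to the layers. -/
theorem coeff_gradedTrace_of_graded [FiniteDimensional k V] (𝒱 : ℕ → Submodule k V)
    [DirectSum.Decomposition 𝒱] (Q : V →ₗ[k] V) (hQ : ∀ n, ∀ v ∈ 𝒱 n, Q v ∈ 𝒱 n) (n : ℕ) :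
    (gradedTrace 𝒱 Q).coeff n = LinearMap.trace k (𝒱 n) (Q.restrict (hQ n)) := by
  rw [coeff_gradedTrace, layerProj, LinearMap.comp_assoc, LinearMap.trace_comp_comm']
  congr 1
  ext v
  have h := DirectSum.decompose_of_mem_same 𝒱 (hQ n v v.2)
  exact h

/-- The coefficients of the Hilbert series are the dimensions of the layers. -/
theorem coeff_hilbertPoly [FiniteDimensional k V] (𝒱 : ℕ → Submodule k V)
    [DirectSum.Decomposition 𝒱] (n : ℕ) :
    (hilbertPoly 𝒱).coeff n = Module.finrank k (𝒱 n) := by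
  refine coeff_finsum_monomial _ ((finite_setOf_layer_ne_bot 𝒱).subset fun i hi h => hi ?_) n
  change (Module.finrank k (𝒱 i) : ℤ) = 0
  rw [h, finrank_bot, Nat.cast_zero]

end GradedTrace

/-! The Nichols algebra is a graded Frobenius algebra: its top layer is a line, and the product
followed by the coordinate `ω` on that line is a nondegenerate pairing of degree `n` with degree `L
- n`.

The source is maximality of the Nichols ideal `I`: an element without constant term all of whose
skew derivatives lie in `I` is itself in `I` (`mem_nicholsIdeal_of_mem_skewKer`). So a
derivation-stable subspace containing `I` properly contains `1`. Let `b` be homogeneous, nonzero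
modulo `I`, with `M b` in `I`. The derivation-stable subspace generated by `I` and `b` is a left
ideal by the Leibniz rule, so it is all of `T(M)`; since derivations lower the degree, it consists
of multiples of `b` plus `I` plus lower degrees (`exists_sub_smul_mem`). Hence only top-degree
elements are annihilated by `M`, and the top layer is a line (`IsTopDegree.isGradedFrobenius`).

An automorphism `Q`, graded or not, preserves the filtration by degree at least `n`
(`isFiltered_of_generated`), so it scales the top layer, which contains every integral. With `λ`
this scalar and `m = L - n`, `ω(P_n Q P_n a · b) = ω(Q(P_n a · Q⁻¹ P_m b)) = λ ω(P_n a · Q⁻¹ P_m b)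
= λ ω(a · P_m Q⁻¹ P_m b)`, and adjoint operators have equal traces. This gives the identities degree
by degree. -/

namespace YetterDrinfeldModule

/-! ### Degree, group action and skew derivations on the tensor algebra -/

variable {k G M : Type*} [Field k] [Group G] [AddCommGroup M] [Module k M]

/-- `f` is a linear form on `M` supported on the layer `M_g`. -/
def IsFormOn (D : YetterDrinfeldModule k G M) (g : G) (f : Module.Dual k M) : Prop :=
  ∀ h : G, h ≠ g → ∀ v ∈ D.layer h, f v = 0

theorem tensorAct_ι (D : YetterDrinfeldModule k G M) (g : G) (v : M) :
    D.tensorAct g (TensorAlgebra.ι k v) = TensorAlgebra.ι k (D.ρ g v) := by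
  simp [tensorAct]

theorem tensorAct_mul (D : YetterDrinfeldModule k G M) (g h : G) (a : TensorAlgebra k M) :
    D.tensorAct (g * h) a = D.tensorAct g (D.tensorAct h a) := by
  have : D.tensorAct (g * h) = (D.tensorAct g).comp (D.tensorAct h) := by
    ext v
    simp [tensorAct]
  exact DFunLike.congr_fun this a

theorem tensorAct_one (D : YetterDrinfeldModule k G M) (a : TensorAlgebra k M) :
    D.tensorAct 1 a = a := by
  have : D.tensorAct 1 = AlgHom.id k _ := by
    ext v
    simp [tensorAct]
  exact DFunLike.congr_fun this a

theorem tensorAct_inv_tensorAct (D : YetterDrinfeldModule k G M) (g : G)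
    (a : TensorAlgebra k M) : D.tensorAct g⁻¹ (D.tensorAct g a) = a := by
  rw [← tensorAct_mul, inv_mul_cancel, tensorAct_one]

theorem tensorAct_tensorAct_inv (D : YetterDrinfeldModule k G M) (g : G)
    (a : TensorAlgebra k M) : D.tensorAct g (D.tensorAct g⁻¹ a) = a := by
  rw [← tensorAct_mul, mul_inv_cancel, tensorAct_one]

theorem tensorAct_mem (D : YetterDrinfeldModule k G M) (g : G) {n : ℕ} {a : TensorAlgebra k M}
    (ha : a ∈ tensorLayer k M n) : D.tensorAct g a ∈ tensorLayer k M n := by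
  induction n generalizing a with
  | zero =>
    rw [tensorLayer, pow_zero] at ha ⊢
    obtain ⟨c, rfl⟩ := Submodule.mem_one.1 ha
    rw [AlgHom.commutes]
    exact Submodule.mem_one.2 ⟨c, rfl⟩
  | succ n ih =>
    rw [tensorLayer, pow_succ] at ha ⊢
    induction ha using Submodule.mul_induction_on' with
    | mem_mul_mem a ha b hb =>
      obtain ⟨v, rfl⟩ := hb
      rw [map_mul, tensorAct_ι]
      exact Submodule.mul_mem_mul (ih ha) ⟨_, rfl⟩
    | add a ha b hb h1 h2 => rw [map_add]; exact add_mem h1 h2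

theorem skewDer_algebraMap (D : YetterDrinfeldModule k G M) (g : G) (f : Module.Dual k M)
    (c : k) : D.skewDer g f (algebraMap k _ c) = 0 := by
  rw [Algebra.algebraMap_eq_smul_one, map_smul, skewDer_one, smul_zero]

theorem skewDer_of_mem_zero (D : YetterDrinfeldModule k G M) (g : G) (f : Module.Dual k M)
    {a : TensorAlgebra k M} (ha : a ∈ tensorLayer k M 0) : D.skewDer g f a = 0 := by
  rw [tensorLayer, pow_zero] at ha
  obtain ⟨c, rfl⟩ := Submodule.mem_one.1 ha
  exact D.skewDer_algebraMap g f c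

theorem skewDer_mem (D : YetterDrinfeldModule k G M) (g : G) (f : Module.Dual k M) {n : ℕ}
    {a : TensorAlgebra k M} (ha : a ∈ tensorLayer k M (n + 1)) :
    D.skewDer g f a ∈ tensorLayer k M n := by
  induction n generalizing a with
  | zero =>
    rw [tensorLayer, zero_add, pow_one] at ha
    obtain ⟨v, rfl⟩ := ha
    rw [skewDer_ι, tensorLayer, pow_zero]
    exact Submodule.mem_one.2 ⟨_, rfl⟩
  | succ n ih =>
    rw [tensorLayer, pow_succ] at ha
    induction ha using Submodule.mul_induction_on' with
    | mem_mul_mem a ha b hb =>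
      obtain ⟨v, rfl⟩ := hb
      rw [skewDer_mul, skewDer_ι, ← Algebra.commutes, ← Algebra.smul_def]
      refine add_mem ?_ (Submodule.smul_mem _ _ (D.tensorAct_mem g ha))
      rw [tensorLayer, pow_succ]
      exact Submodule.mul_mem_mul (ih ha) ⟨v, rfl⟩
    | add a ha b hb h1 h2 => rw [map_add]; exact add_mem h1 h2

theorem proj_of_mem {n : ℕ} {a : TensorAlgebra k M} (ha : a ∈ tensorLayer k M n) :
    GradedAlgebra.proj (tensorLayer k M) n a = a := by
  rw [GradedAlgebra.proj_apply, DirectSum.decompose_of_mem_same _ ha]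

theorem proj_of_mem_ne {m n : ℕ} {a : TensorAlgebra k M} (ha : a ∈ tensorLayer k M m)
    (h : m ≠ n) : GradedAlgebra.proj (tensorLayer k M) n a = 0 := by
  rw [GradedAlgebra.proj_apply, DirectSum.decompose_of_mem_ne _ ha h]

theorem proj_mem (n : ℕ) (a : TensorAlgebra k M) :
    GradedAlgebra.proj (tensorLayer k M) n a ∈ tensorLayer k M n := by
  rw [GradedAlgebra.proj_apply]
  exact SetLike.coe_mem _

theorem proj_skewDer (D : YetterDrinfeldModule k G M) (g : G) (f : Module.Dual k M) (n : ℕ)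
    (a : TensorAlgebra k M) : GradedAlgebra.proj (tensorLayer k M) n (D.skewDer g f a) =
      D.skewDer g f (GradedAlgebra.proj (tensorLayer k M) (n + 1) a) := by
  induction a using DirectSum.Decomposition.inductionOn (tensorLayer k M) with
  | zero => simp
  | @homogeneous i m =>
    cases i with
    | zero =>
      rw [proj_of_mem_ne m.2 (Nat.succ_ne_zero n).symm, D.skewDer_of_mem_zero g f m.2, map_zero,
        map_zero]
    | succ i =>
      by_cases h : i = n
      · subst h
        rw [proj_of_mem m.2, proj_of_mem (D.skewDer_mem g f m.2)]
      · rw [proj_of_mem_ne m.2 (by omega), proj_of_mem_ne (D.skewDer_mem g f m.2) h, map_zero]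
  | add a b ha hb => simp only [map_add, ha, hb]

theorem proj_tensorAct (D : YetterDrinfeldModule k G M) (g : G) (n : ℕ)
    (a : TensorAlgebra k M) : GradedAlgebra.proj (tensorLayer k M) n (D.tensorAct g a) =
      D.tensorAct g (GradedAlgebra.proj (tensorLayer k M) n a) := by
  induction a using DirectSum.Decomposition.inductionOn (tensorLayer k M) with
  | zero => simp
  | @homogeneous i m =>
    by_cases h : i = n
    · subst h
      rw [proj_of_mem m.2, proj_of_mem (D.tensorAct_mem g m.2)]
    · rw [proj_of_mem_ne m.2 h, proj_of_mem_ne (D.tensorAct_mem g m.2) h, map_zero]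
  | add a b ha hb => simp only [map_add, ha, hb]

/-- Conjugation by `g` permutes the skew derivations; with `IsFormOn.comp_inv` it permutes those
relevant to admissibility. -/
theorem tensorAct_skewDer (D : YetterDrinfeldModule k G M) (g h : G) (f : Module.Dual k M)
    (a : TensorAlgebra k M) : D.tensorAct g (D.skewDer h f a) =
      D.skewDer (g * h * g⁻¹) (f ∘ₗ D.ρ g⁻¹) (D.tensorAct g a) := by
  induction a using TensorAlgebra.induction with
  | algebraMap r => simp only [skewDer_algebraMap, AlgHom.commutes, map_zero]
  | ι v => simp [skewDer_ι, tensorAct_ι]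
  | mul a b ha hb =>
    rw [skewDer_mul, map_add, map_mul, map_mul, map_mul, skewDer_mul, ha, hb, tensorAct_mul,
      tensorAct_mul, tensorAct_inv_tensorAct]
  | add a b ha hb => simp only [map_add, ha, hb]

theorem IsFormOn.comp_inv {D : YetterDrinfeldModule k G M} {h : G} {f : Module.Dual k M}
    (hf : D.IsFormOn h f) (g : G) : D.IsFormOn (g * h * g⁻¹) (f ∘ₗ D.ρ g⁻¹) := by
  intro x hx v hv
  refine hf (g⁻¹ * x * g) (fun h' => hx ?_) _ ?_
  · rw [← h']; group
  · have := D.map_layer g⁻¹ x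
    rw [inv_inv] at this
    rw [← this]
    exact Submodule.mem_map_of_mem hv

/-- Linear forms on one layer, extended by zero to the other layers, separate the points of `M`. -/
theorem eq_zero_of_forall_form (D : YetterDrinfeldModule k G M) {v : M}
    (hv : ∀ g f, D.IsFormOn g f → f v = 0) : v = 0 := by
  classical
  have hint : DirectSum.IsInternal D.layer :=
    DirectSum.isInternal_submodule_of_iSupIndep_of_iSup_eq_top D.iSupIndep_layer D.iSup_layer
  let _ := hint.chooseDecomposition
  have h0 : ∀ g, ((DirectSum.decompose D.layer v) g : M) = 0 := by
    intro g
    rw [← Module.forall_dual_apply_eq_zero_iff k]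
    intro φ
    refine hv g (φ ∘ₗ (D.layer g).subtype ∘ₗ DirectSum.component k G (fun i => D.layer i) g ∘ₗ
      (DirectSum.decomposeLinearEquiv D.layer).toLinearMap) fun h hh w hw => ?_
    have := DirectSum.decompose_of_mem_ne D.layer hw hh
    change φ ((DirectSum.decompose D.layer w) g : M) = 0
    rw [this, map_zero]
  apply (DirectSum.decompose D.layer).injective
  rw [DirectSum.decompose_zero]
  exact DFinsupp.ext fun g => Subtype.ext (h0 g)

/-- The preimage of the Nichols ideal under `g` is again admissible, hence contained in the largest
admissible ideal. -/
theorem mem_nicholsIdeal_of_tensorAct_mem (D : YetterDrinfeldModule k G M) (g : G)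
    {a : TensorAlgebra k M} (ha : D.tensorAct g a ∈ D.nicholsIdeal) : a ∈ D.nicholsIdeal := by
  have hI := D.isGreatest_nicholsIdeal.1
  have : D.IsNicholsAdmissible (D.nicholsIdeal.comap (D.tensorAct g)) := by
    refine ⟨⟨fun {a} b ha => ?_⟩, fun h => ?_, fun n a ha => ?_, fun h f hf a ha => ?_,
      fun v hv => ?_⟩
    · rw [Ideal.mem_comap] at ha ⊢
      rw [map_mul]
      exact hI.isTwoSided.mul_mem_of_left _ ha
    · have h1 : (1 : TensorAlgebra k M) ∈ D.nicholsIdeal.comap (D.tensorAct g) :=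
        h ▸ Submodule.mem_top
      rw [Ideal.mem_comap, map_one] at h1
      exact hI.ne_top ((Ideal.eq_top_iff_one _).2 h1)
    · rw [Ideal.mem_comap] at ha ⊢
      have := hI.isHomogeneous n ha
      rw [← GradedAlgebra.proj_apply, proj_tensorAct] at this
      exact this
    · rw [Ideal.mem_comap] at ha ⊢
      rw [tensorAct_skewDer]
      exact hI.skewDer_mem _ _ (IsFormOn.comp_inv hf g) _ ha
    · rw [Ideal.mem_comap, tensorAct_ι] at hv
      have := hI.inf_eq_bot _ hv
      rw [← Representation.inv_self_apply D.ρ g v, this, map_zero]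
  exact D.isGreatest_nicholsIdeal.2 this (Ideal.mem_comap.2 ha)

/-! ### Elements with vanishing skew derivatives -/

/-- The elements of the augmentation ideal all of whose skew derivatives lie in the Nichols
ideal. -/
def skewKer (D : YetterDrinfeldModule k G M) : Submodule k (TensorAlgebra k M) where
  carrier := {a | TensorAlgebra.algebraMapInv a = 0 ∧
    ∀ g f, D.IsFormOn g f → D.skewDer g f a ∈ D.nicholsIdeal}
  zero_mem' := ⟨map_zero _, fun g f _ => by rw [map_zero]; exact zero_mem _⟩
  add_mem' := fun ha hb => ⟨by rw [map_add, ha.1, hb.1, add_zero], fun g f hf => by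
    rw [map_add]; exact add_mem (ha.2 g f hf) (hb.2 g f hf)⟩
  smul_mem' := fun c a ha => ⟨by rw [map_smul, ha.1, smul_zero], fun g f hf => by
    rw [map_smul]; exact Submodule.smul_of_tower_mem _ c (ha.2 g f hf)⟩

theorem nicholsIdeal_le_skewKer (D : YetterDrinfeldModule k G M) {a : TensorAlgebra k M}
    (ha : a ∈ D.nicholsIdeal) : a ∈ D.skewKer :=
  ⟨D.isGreatest_nicholsIdeal.1.algebraMapInv_eq_zero ha,
    fun g f hf => D.isGreatest_nicholsIdeal.1.skewDer_mem g f hf a ha⟩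

theorem algebraMapInv_tensorAct (D : YetterDrinfeldModule k G M) (g : G)
    (a : TensorAlgebra k M) :
    TensorAlgebra.algebraMapInv (D.tensorAct g a) = TensorAlgebra.algebraMapInv a := by
  have : (TensorAlgebra.algebraMapInv : TensorAlgebra k M →ₐ[k] k).comp (D.tensorAct g) =
      TensorAlgebra.algebraMapInv := by
    ext v
    simp [tensorAct, TensorAlgebra.algebraMapInv]
  exact DFunLike.congr_fun this a

theorem tensorAct_mem_skewKer (D : YetterDrinfeldModule k G M) (g : G)
    {a : TensorAlgebra k M} (ha : a ∈ D.skewKer) : D.tensorAct g a ∈ D.skewKer := by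
  refine ⟨by rw [algebraMapInv_tensorAct]; exact ha.1, fun h f hf => ?_⟩
  apply D.mem_nicholsIdeal_of_tensorAct_mem g⁻¹
  rw [tensorAct_skewDer, tensorAct_inv_tensorAct]
  exact ha.2 _ _ (hf.comp_inv g⁻¹)

theorem proj_mem_skewKer (D : YetterDrinfeldModule k G M) (n : ℕ)
    {a : TensorAlgebra k M} (ha : a ∈ D.skewKer) :
    GradedAlgebra.proj (tensorLayer k M) n a ∈ D.skewKer := by
  cases n with
  | zero => rw [proj_zero_eq, ha.1, map_zero]; exact zero_mem _
  | succ n =>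
    refine ⟨?_, fun g f hf => ?_⟩
    · apply (TensorAlgebra.algebraMap_leftInverse (R := k) M).injective
      rw [map_zero, ← proj_zero_eq, proj_of_mem_ne (proj_mem _ _) (Nat.succ_ne_zero n)]
    · rw [← proj_skewDer]
      exact D.isGreatest_nicholsIdeal.1.isHomogeneous n (ha.2 g f hf)

/-- Homogeneous generators of the two-sided ideal generated by `skewKer`. -/
def skewKerGen (D : YetterDrinfeldModule k G M) : Set (TensorAlgebra k M) :=
  {a | ∃ w ∈ D.skewKer, ∃ y, SetLike.IsHomogeneousElem (tensorLayer k M) w ∧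
    SetLike.IsHomogeneousElem (tensorLayer k M) y ∧ w * y = a}

/-- `Ideal.span` produces left ideals, so closure under right multiplication is built into the
generators. Their homogeneity costs nothing, since `skewKer` contains the components of its
elements. -/
theorem mul_mem_span_skewKerGen (D : YetterDrinfeldModule k G M) {w : TensorAlgebra k M}
    (hw : w ∈ D.skewKer) (y : TensorAlgebra k M) : w * y ∈ Ideal.span D.skewKerGen := by
  classical
  rw [← DirectSum.sum_support_decompose (tensorLayer k M) w, Finset.sum_mul]
  refine sum_mem fun i _ => ?_
  rw [← DirectSum.sum_support_decompose (tensorLayer k M) y, Finset.mul_sum]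
  refine sum_mem fun j _ => ?_
  exact Ideal.subset_span ⟨_, D.proj_mem_skewKer i hw, _, ⟨i, SetLike.coe_mem _⟩,
    ⟨j, SetLike.coe_mem _⟩, rfl⟩

theorem isNicholsAdmissible_span_skewKerGen (D : YetterDrinfeldModule k G M) :
    D.IsNicholsAdmissible (Ideal.span D.skewKerGen) := by
  have hε : ∀ a ∈ Ideal.span D.skewKerGen, TensorAlgebra.algebraMapInv a = 0 := by
    intro a ha
    induction ha using Submodule.span_induction with
    | mem a ha =>
      obtain ⟨w, hw, y, -, -, rfl⟩ := ha
      rw [map_mul, hw.1, zero_mul]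
    | zero => exact map_zero _
    | add a b _ _ ha hb => rw [map_add, ha, hb, add_zero]
    | smul c a _ ha => rw [smul_eq_mul, map_mul, ha, mul_zero]
  have hder : ∀ (g : G) (f : Module.Dual k M), D.IsFormOn g f →
      ∀ a ∈ Ideal.span D.skewKerGen, D.skewDer g f a ∈ Ideal.span D.skewKerGen := by
    intro g f hf a ha
    induction ha using Submodule.span_induction with
    | mem a ha =>
      obtain ⟨w, hw, y, -, -, rfl⟩ := ha
      -- In `∂(w y) = ∂w · y + (g.w) · ∂y`, the factor `∂w` lies in the Nichols ideal, hence again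
      -- in `skewKer`, and `g.w` lies in `skewKer` by stability under `G`.
      rw [skewDer_mul]
      exact add_mem (D.mul_mem_span_skewKerGen (D.nicholsIdeal_le_skewKer (hw.2 g f hf)) y)
        (D.mul_mem_span_skewKerGen (D.tensorAct_mem_skewKer g hw) _)
    | zero => rw [map_zero]; exact zero_mem _
    | add a b _ _ ha hb => rw [map_add]; exact add_mem ha hb
    | smul c a h ha =>
      rw [smul_eq_mul, skewDer_mul]
      exact add_mem (Ideal.mul_mem_left _ _ h) (Ideal.mul_mem_left _ _ ha)
  refine ⟨⟨fun {a} b ha => ?_⟩, fun h => ?_, ?_, hder, fun v hv => ?_⟩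
  · induction ha using Submodule.span_induction with
    | mem a ha =>
      obtain ⟨w, hw, y, -, -, rfl⟩ := ha
      rw [mul_assoc]
      exact D.mul_mem_span_skewKerGen hw _
    | zero => rw [zero_mul]; exact zero_mem _
    | add x y _ _ hx hy => rw [add_mul]; exact add_mem hx hy
    | smul c x _ hx => rw [smul_eq_mul, mul_assoc]; exact Ideal.mul_mem_left _ _ hx
  · have := hε 1 (h ▸ Submodule.mem_top)
    rw [map_one] at this
    exact one_ne_zero this
  · refine Ideal.homogeneous_span _ _ ?_
    rintro _ ⟨w, -, y, ⟨i, hi⟩, ⟨j, hj⟩, rfl⟩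
    exact ⟨i + j, SetLike.GradedMul.mul_mem hi hj⟩
  -- The derivative of `v` is the scalar `f v`; it lies in an ideal whose elements have no constant
  -- term, so it vanishes.
  · refine D.eq_zero_of_forall_form fun g f hf => ?_
    have := hε _ (hder g f hf _ hv)
    rw [skewDer_ι] at this
    rwa [TensorAlgebra.algebraMap_leftInverse (R := k) M] at this

/-- An element of the augmentation ideal all of whose skew derivatives vanish in the Nichols
algebra vanishes in the Nichols algebra. -/
theorem mem_nicholsIdeal_of_mem_skewKer (D : YetterDrinfeldModule k G M)
    {a : TensorAlgebra k M} (ha : a ∈ D.skewKer) : a ∈ D.nicholsIdeal := by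
  have := D.isGreatest_nicholsIdeal.2 D.isNicholsAdmissible_span_skewKerGen
  apply this
  simpa using D.mul_mem_span_skewKerGen ha 1

/-! ### Derivation-stable subspaces and elements annihilated by `M` -/

/-- A subspace of the tensor algebra is stable under the skew derivations. -/
def IsSkewStable (D : YetterDrinfeldModule k G M) (W : Submodule k (TensorAlgebra k M)) : Prop :=
  ∀ g f, D.IsFormOn g f → ∀ a ∈ W, D.skewDer g f a ∈ W

/-- If `1 ∉ W`, every `b ∈ W` lies in the Nichols ideal, by induction on a strict degree bound: the
derivatives of `b` have smaller degree, so `b` is congruent to its constant term, which then lies in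
`W` and must be zero. -/
theorem IsSkewStable.one_mem {D : YetterDrinfeldModule k G M}
    {W : Submodule k (TensorAlgebra k M)} (hW : D.IsSkewStable W)
    (hI : D.nicholsIdeal.restrictScalars k ≤ W) {a : TensorAlgebra k M} (ha : a ∈ W)
    (haI : a ∉ D.nicholsIdeal) : 1 ∈ W := by
  classical
  by_contra h1
  have key : ∀ m, ∀ b ∈ W, (∀ n, m ≤ n → GradedAlgebra.proj (tensorLayer k M) n b = 0) →
      b ∈ D.nicholsIdeal := by
    intro m
    induction m with
    | zero =>
      intro b _ hb
      rw [← DirectSum.sum_support_decompose (tensorLayer k M) b]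
      refine sum_mem fun i _ => ?_
      have := hb i (Nat.zero_le i)
      rw [GradedAlgebra.proj_apply] at this
      rw [this]
      exact zero_mem _
    | succ m ih =>
      intro b hbW hb
      have hder : ∀ g f, D.IsFormOn g f → D.skewDer g f b ∈ D.nicholsIdeal := by
        intro g f hf
        refine ih _ (hW g f hf b hbW) fun n hn => ?_
        rw [proj_skewDer, hb _ (by omega), map_zero]
      have hc : b - algebraMap k _ (TensorAlgebra.algebraMapInv b) ∈ D.nicholsIdeal := by
        refine D.mem_nicholsIdeal_of_mem_skewKer ⟨?_, fun g f hf => ?_⟩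
        · rw [map_sub, TensorAlgebra.algebraMap_leftInverse (R := k) M, sub_self]
        · rw [map_sub, skewDer_algebraMap, sub_zero]
          exact hder g f hf
      have hc2 : algebraMap k (TensorAlgebra k M) (TensorAlgebra.algebraMapInv b) ∈ W := by
        have := sub_mem hbW (hI hc)
        rwa [sub_sub_cancel] at this
      by_cases h0 : TensorAlgebra.algebraMapInv b = 0
      · rwa [h0, map_zero, sub_zero] at hc
      · refine absurd ?_ h1
        rw [Algebra.algebraMap_eq_smul_one] at hc2
        exact (Submodule.smul_mem_iff _ h0).1 hc2
  -- The bound in `key` is exclusive, hence one more than the highest degree occurring in `a`.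
  refine haI (key (((DirectSum.decompose (tensorLayer k M) a).support.sup id) + 1) a ha
    fun n hn => ?_)
  rw [GradedAlgebra.proj_apply]
  by_contra h
  have hmem : n ∈ (DirectSum.decompose (tensorLayer k M) a).support := by
    rw [DFinsupp.mem_support_iff]
    exact fun h' => h (by rw [h']; rfl)
  have := Finset.le_sup (f := id) hmem
  simp only [id] at this
  omega

theorem mul_sub_smul_mem (D : YetterDrinfeldModule k G M) {b : TensorAlgebra k M}
    (hM : ∀ v : M, TensorAlgebra.ι k v * b ∈ D.nicholsIdeal) (x : TensorAlgebra k M) :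
    x * b - TensorAlgebra.algebraMapInv x • b ∈ D.nicholsIdeal := by
  induction x using TensorAlgebra.induction with
  | algebraMap r =>
    rw [TensorAlgebra.algebraMap_leftInverse (R := k) M, ← Algebra.smul_def, sub_self]
    exact zero_mem _
  | ι v => simpa [TensorAlgebra.algebraMapInv] using hM v
  | mul x y hx hy =>
    have h : x * y * b - TensorAlgebra.algebraMapInv (x * y) • b =
        x * (y * b - TensorAlgebra.algebraMapInv y • b) +
          TensorAlgebra.algebraMapInv y • (x * b - TensorAlgebra.algebraMapInv x • b) := by
      rw [map_mul, mul_sub, smul_sub, smul_smul, mul_smul_comm, mul_assoc,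
        mul_comm (TensorAlgebra.algebraMapInv y), sub_add_sub_cancel]
    rw [h]
    exact add_mem (Ideal.mul_mem_left _ _ hy) (Submodule.smul_of_tower_mem _ _ hx)
  | add x y hx hy =>
    rw [add_mul, map_add, add_smul, add_sub_add_comm]
    exact add_mem hx hy

/-- If a homogeneous element of the tensor algebra is nonzero in the Nichols algebra but
annihilated there by left multiplication with `M`, then every element is a sum of a multiple of
it, an element of the Nichols ideal and an element of lower degree. -/
theorem exists_sub_smul_mem (D : YetterDrinfeldModule k G M) {n : ℕ} {b : TensorAlgebra k M}
    (hb : b ∈ tensorLayer k M n) (hbI : b ∉ D.nicholsIdeal)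
    (hM : ∀ v : M, TensorAlgebra.ι k v * b ∈ D.nicholsIdeal) {m : ℕ} (hm : n ≤ m)
    {a : TensorAlgebra k M} (ha : a ∈ tensorLayer k M m) :
    ∃ c : k, a - c • b ∈ D.nicholsIdeal ∧ (m ≠ n → c = 0) := by
  set W : Submodule k (TensorAlgebra k M) :=
    sInf {W | D.nicholsIdeal.restrictScalars k ≤ W ∧ b ∈ W ∧ D.IsSkewStable W} with hWdef
  have hIW : D.nicholsIdeal.restrictScalars k ≤ W := le_sInf fun _ h => h.1
  have hbW : b ∈ W := (Submodule.mem_sInf).2 fun _ h => h.2.1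
  have hW : D.IsSkewStable W := fun g f hf a ha => Submodule.mem_sInf.2 fun V hV =>
    hV.2.2 g f hf a (Submodule.mem_sInf.1 ha V hV)
  have hmin : ∀ V : Submodule k (TensorAlgebra k M), D.nicholsIdeal.restrictScalars k ≤ V →
      b ∈ V → D.IsSkewStable V → W ≤ V := fun V h1 h2 h3 => sInf_le ⟨h1, h2, h3⟩
  -- The elements of `W` whose left multiples stay in `W` form a derivation-stable subspace
  -- containing `I` and `b`, so by minimality they are all of `W`.
  have hleft : ∀ w ∈ W, ∀ x, x * w ∈ W := by
    let V : Submodule k (TensorAlgebra k M) :=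
      { carrier := {w | w ∈ W ∧ ∀ x, x * w ∈ W}
        zero_mem' := ⟨zero_mem _, fun x => by rw [mul_zero]; exact zero_mem _⟩
        add_mem' := fun h1 h2 => ⟨add_mem h1.1 h2.1, fun x => by
          rw [mul_add]; exact add_mem (h1.2 x) (h2.2 x)⟩
        smul_mem' := fun c w h => ⟨Submodule.smul_mem _ c h.1, fun x => by
          rw [mul_smul_comm]; exact Submodule.smul_mem _ c (h.2 x)⟩ }
    have hV : W ≤ V := by
      refine hmin V (fun w hw => ⟨hIW hw, fun x => hIW (Ideal.mul_mem_left _ x hw)⟩)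
        ⟨hbW, fun x => ?_⟩ fun g f hf w hw => ⟨hW g f hf w hw.1, fun x => ?_⟩
      · rw [← sub_add_cancel (x * b) (TensorAlgebra.algebraMapInv x • b)]
        exact add_mem (hIW (D.mul_sub_smul_mem hM x)) (Submodule.smul_mem _ _ hbW)
      -- The twist by `g⁻¹` turns the second Leibniz term of `∂((g⁻¹.x) w)` into exactly `x · ∂w`;
      -- the first is a left multiple of `w`.
      · have h1 := hW g f hf _ (hw.2 (D.tensorAct g⁻¹ x))
        rw [skewDer_mul, tensorAct_tensorAct_inv] at h1
        exact (Submodule.add_mem_iff_right _ (hw.2 _)).1 h1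
    exact fun w hw => (hV hw).2
  have htop : ∀ x, x ∈ W := fun x => by
    simpa using hleft 1 (hW.one_mem hIW hbW hbI) x
  -- Upper bound for `W`: multiples of `b`, plus the Nichols ideal, plus degrees below `n`.
  let V : Submodule k (TensorAlgebra k M) :=
    { carrier := {w | ∃ c : k, ∀ i, n ≤ i →
        GradedAlgebra.proj (tensorLayer k M) i (w - c • b) ∈ D.nicholsIdeal}
      zero_mem' := ⟨0, fun i _ => by simp⟩
      add_mem' := by
        rintro x y ⟨c, hc⟩ ⟨d, hd⟩
        refine ⟨c + d, fun i hi => ?_⟩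
        rw [add_smul, add_sub_add_comm, map_add]
        exact add_mem (hc i hi) (hd i hi)
      smul_mem' := by
        rintro r x ⟨c, hc⟩
        refine ⟨r * c, fun i hi => ?_⟩
        rw [mul_smul, ← smul_sub, map_smul]
        exact Submodule.smul_of_tower_mem _ r (hc i hi) }
  have hV : W ≤ V := by
    refine hmin V (fun w hw => ⟨0, fun i _ => ?_⟩) ⟨1, fun i _ => by simp⟩ ?_
    · rw [zero_smul, sub_zero]
      exact D.isGreatest_nicholsIdeal.1.isHomogeneous i hw
    · rintro g f hf w ⟨c, hc⟩
      -- Components of `∂w` in degree `i ≥ n` come from degree `i + 1 > n`, where `b` has no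
      -- component; hence the coefficient `0`.
      refine ⟨0, fun i hi => ?_⟩
      have h := D.isGreatest_nicholsIdeal.1.skewDer_mem g f hf _ (hc (i + 1) (by omega))
      rwa [map_sub, map_smul, proj_of_mem_ne hb (by omega), smul_zero, sub_zero,
        ← proj_skewDer, ← sub_zero (D.skewDer g f w), ← zero_smul k b] at h
  obtain ⟨c, hc⟩ := hV (htop a)
  have h := hc m hm
  by_cases hmn : m = n
  · subst hmn
    refine ⟨c, ?_, fun h => absurd rfl h⟩
    rwa [map_sub, map_smul, proj_of_mem ha, proj_of_mem hb] at h
  · refine ⟨0, ?_, fun _ => rfl⟩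
    rwa [map_sub, map_smul, proj_of_mem ha, proj_of_mem_ne hb (Ne.symm hmn), smul_zero,
      ← zero_smul k b] at h

end YetterDrinfeldModule

theorem Polynomial.toLaurent_eq_of_coeff_eq {R : Type*} [CommSemiring R] {p q : Polynomial R}
    {L : ℕ} {c : R} (hp : ∀ n, L < n → p.coeff n = 0) (hq : ∀ n, L < n → q.coeff n = 0)
    (h : ∀ n ≤ L, p.coeff n = c * q.coeff (L - n)) :
    p.toLaurent = LaurentPolynomial.C c * LaurentPolynomial.T (L : ℤ) *
      LaurentPolynomial.invert q.toLaurent := by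
  have hdeg : ∀ r : Polynomial R, (∀ n, L < n → r.coeff n = 0) → r.natDegree < L + 1 :=
    fun r hr => Nat.lt_succ_of_le (Polynomial.natDegree_le_iff_coeff_eq_zero.2 hr)
  rw [p.as_sum_range' (L + 1) (hdeg p hp), q.as_sum_range' (L + 1) (hdeg q hq), map_sum, map_sum,
    map_sum, Finset.mul_sum,
    ← Finset.sum_range_reflect (fun i => Polynomial.toLaurent (Polynomial.monomial i _))]
  refine Finset.sum_congr rfl fun i hi => ?_
  have hi' : i ≤ L := Nat.lt_succ_iff.1 (Finset.mem_range.1 hi)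
  have e : L + 1 - 1 - i = L - i := by omega
  rw [e, h _ (Nat.sub_le L i), Nat.sub_sub_self hi', ← Polynomial.C_mul_X_pow_eq_monomial,
    ← Polynomial.C_mul_X_pow_eq_monomial, Polynomial.toLaurent_C_mul_X_pow,
    Polynomial.toLaurent_C_mul_X_pow, map_mul, map_mul,
    LaurentPolynomial.invert_C, LaurentPolynomial.invert_T, Nat.cast_sub hi', sub_eq_add_neg,
    LaurentPolynomial.T_add]
  ring

/-! ### Layer projections and the filtration by degree -/

section LayerProj

variable {k V : Type*} [Field k] [AddCommGroup V] [Module k V] (𝒱 : ℕ → Submodule k V)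
  [DirectSum.Decomposition 𝒱]

theorem layerProj_apply (n : ℕ) (v : V) :
    layerProj 𝒱 n v = (DirectSum.decompose 𝒱 v n : V) := rfl

theorem layerProj_mem (n : ℕ) (v : V) : layerProj 𝒱 n v ∈ 𝒱 n :=
  (DirectSum.decompose 𝒱 v n).2

theorem layerProj_of_mem {n : ℕ} {v : V} (hv : v ∈ 𝒱 n) : layerProj 𝒱 n v = v :=
  DirectSum.decompose_of_mem_same 𝒱 hv

theorem layerProj_of_mem_ne {m n : ℕ} {v : V} (hv : v ∈ 𝒱 m) (h : m ≠ n) :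
    layerProj 𝒱 n v = 0 :=
  DirectSum.decompose_of_mem_ne 𝒱 hv h

theorem layerProj_comp_self (n : ℕ) : layerProj 𝒱 n ∘ₗ layerProj 𝒱 n = layerProj 𝒱 n :=
  LinearMap.ext fun v => layerProj_of_mem 𝒱 (layerProj_mem 𝒱 n v)

theorem layerProj_eq_zero {n : ℕ} (h : 𝒱 n = ⊥) : layerProj 𝒱 n = 0 := by
  ext v
  have := layerProj_mem 𝒱 n v
  rwa [h, Submodule.mem_bot] at this

theorem sum_layerProj {L : ℕ} (h : ∀ n, L < n → 𝒱 n = ⊥) :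
    ∑ n ∈ Finset.range (L + 1), layerProj 𝒱 n = LinearMap.id := by
  ext v
  induction v using DirectSum.Decomposition.inductionOn 𝒱 with
  | zero => simp
  | @homogeneous i m =>
    rw [LinearMap.sum_apply, LinearMap.id_apply]
    by_cases hi : i ≤ L
    · rw [Finset.sum_eq_single i (fun j _ hj => layerProj_of_mem_ne 𝒱 m.2 (Ne.symm hj))
        (fun h => absurd (Finset.mem_range.2 (Nat.lt_succ_of_le hi)) h), layerProj_of_mem 𝒱 m.2]
    · have h0 : (m : V) = 0 :=
        (Submodule.mem_bot k).1 (h i (not_le.1 hi) ▸ m.2)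
      simp [h0]
  | add a b ha hb => rw [map_add, map_add, ha, hb]

/-- The vectors all of whose components in degrees less than `n` vanish. -/
def upperLayers (n : ℕ) : Submodule k V := ⨅ i : Fin n, LinearMap.ker (layerProj 𝒱 i)

theorem mem_upperLayers {n : ℕ} {v : V} :
    v ∈ upperLayers 𝒱 n ↔ ∀ i < n, layerProj 𝒱 i v = 0 := by
  simp [upperLayers, Fin.forall_iff]

theorem mem_upperLayers_of_mem {m n : ℕ} (h : n ≤ m) {v : V} (hv : v ∈ 𝒱 m) :
    v ∈ upperLayers 𝒱 n :=
  (mem_upperLayers 𝒱).2 fun _ hi => layerProj_of_mem_ne 𝒱 hv (by omega)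

theorem upperLayers_induction {n : ℕ} {W : Submodule k V} (h : ∀ m, n ≤ m → 𝒱 m ≤ W) :
    upperLayers 𝒱 n ≤ W := by
  classical
  intro v hv
  rw [← DirectSum.sum_support_decompose 𝒱 v]
  refine sum_mem fun i _ => ?_
  by_cases hi : i < n
  · have := (mem_upperLayers 𝒱).1 hv i hi
    rw [layerProj_apply] at this
    rw [this]
    exact zero_mem _
  · exact h i (not_lt.1 hi) (SetLike.coe_mem _)

end LayerProj

/-! ### Graded Frobenius algebras and trace duality -/

section GradedFrobenius

variable {k A : Type*} [Field k] [Ring A] [Algebra k A] (𝒜 : ℕ → Submodule k A)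

theorem mul_mem_upperLayers [GradedAlgebra 𝒜] {m n : ℕ} {a b : A} (ha : a ∈ upperLayers 𝒜 m)
    (hb : b ∈ upperLayers 𝒜 n) : a * b ∈ upperLayers 𝒜 (m + n) := by
  have h1 : upperLayers 𝒜 m ≤ (upperLayers 𝒜 (m + n)).comap (LinearMap.mulRight k b) := by
    refine upperLayers_induction 𝒜 fun i hi x hx => ?_
    have h2 : upperLayers 𝒜 n ≤ (upperLayers 𝒜 (m + n)).comap (LinearMap.mulLeft k x) :=
      upperLayers_induction 𝒜 fun j hj y hy =>
        mem_upperLayers_of_mem 𝒜 (add_le_add hi hj) (SetLike.GradedMul.mul_mem hx hy)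
    exact h2 hb
  exact h1 ha

/-- A graded algebra with one-dimensional top layer `𝒜 L` such that the multiplication
`𝒜 (L - n) × 𝒜 n → 𝒜 L` is nondegenerate in the second argument. -/
structure IsGradedFrobenius (L : ℕ) : Prop where
  eq_bot : ∀ n, L < n → 𝒜 n = ⊥
  finrank_top : Module.finrank k (𝒜 L) = 1
  exists_mul_ne_zero : ∀ n ≤ L, ∀ a ∈ 𝒜 n, a ≠ 0 → ∃ b ∈ 𝒜 (L - n), b * a ≠ 0

variable {𝒜} [GradedAlgebra 𝒜] {L : ℕ}

theorem upperLayers_le_top (h : IsGradedFrobenius 𝒜 L) : upperLayers 𝒜 L ≤ 𝒜 L := by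
  refine upperLayers_induction 𝒜 fun m hm => ?_
  obtain rfl | hlt := hm.eq_or_lt
  · exact le_rfl
  · rw [h.eq_bot m hlt]; exact bot_le

theorem IsGradedFrobenius.exists_form (h : IsGradedFrobenius 𝒜 L) :
    ∃ ω : Module.Dual k A, (∀ n, n ≠ L → ∀ a ∈ 𝒜 n, ω a = 0) ∧ ∀ a ∈ 𝒜 L, ω a = 0 → a = 0 := by
  have : FiniteDimensional k (𝒜 L) := Module.finite_of_finrank_eq_succ h.finrank_top
  let e : 𝒜 L ≃ₗ[k] k := LinearEquiv.ofFinrankEq _ _ (by rw [h.finrank_top, Module.finrank_self])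
  refine ⟨e.toLinearMap ∘ₗ DirectSum.component k ℕ (fun i => 𝒜 i) L ∘ₗ
    (DirectSum.decomposeLinearEquiv 𝒜).toLinearMap, fun n hn a ha => ?_, fun a ha h0 => ?_⟩
  · have : DirectSum.decompose 𝒜 a L = 0 := Subtype.ext (DirectSum.decompose_of_mem_ne 𝒜 ha hn)
    change e (DirectSum.decompose 𝒜 a L) = 0
    rw [this, map_zero]
  · have h1 : e (DirectSum.decompose 𝒜 a L) = 0 := h0
    rw [LinearEquiv.map_eq_zero_iff] at h1
    rw [← DirectSum.decompose_of_mem_same 𝒜 ha, h1]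
    rfl

/-- The form sees only degree `L`, so `P_n` and `P_(L-n)` are adjoint for the pairing `ω(a b)`. -/
theorem form_layerProj_mul {ω : Module.Dual k A} (hω : ∀ n, n ≠ L → ∀ a ∈ 𝒜 n, ω a = 0)
    {n : ℕ} (hn : n ≤ L) (a b : A) :
    ω (layerProj 𝒜 n a * b) = ω (a * layerProj 𝒜 (L - n) b) := by
  induction a using DirectSum.Decomposition.inductionOn 𝒜 with
  | zero => simp
  | add x y hx hy => rw [map_add, add_mul, add_mul, map_add, map_add, hx, hy]
  | @homogeneous i x =>
    induction b using DirectSum.Decomposition.inductionOn 𝒜 with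
    | zero => simp
    | add y z hy hz => rw [map_add, mul_add, mul_add, map_add, map_add, hy, hz]
    | @homogeneous j y =>
      by_cases hij : i + j = L
      · by_cases hi : i = n
        · rw [hi.symm, layerProj_of_mem 𝒜 x.2,
            layerProj_of_mem 𝒜 (by rw [show L - i = j by omega]; exact y.2)]
        · rw [layerProj_of_mem_ne 𝒜 x.2 hi, layerProj_of_mem_ne 𝒜 y.2 (by omega), zero_mul,
            mul_zero]
      · have h0 := hω _ hij _ (SetLike.GradedMul.mul_mem x.2 y.2)
        have h1 : layerProj 𝒜 n x = x ∨ layerProj 𝒜 n (x : A) = 0 := by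
          by_cases hi : i = n
          · subst hi; exact Or.inl (layerProj_of_mem 𝒜 x.2)
          · exact Or.inr (layerProj_of_mem_ne 𝒜 x.2 hi)
        have h2 : layerProj 𝒜 (L - n) y = y ∨ layerProj 𝒜 (L - n) (y : A) = 0 := by
          by_cases hj : j = L - n
          · subst hj; exact Or.inl (layerProj_of_mem 𝒜 y.2)
          · exact Or.inr (layerProj_of_mem_ne 𝒜 y.2 hj)
        rcases h1 with h1 | h1 <;> rcases h2 with h2 | h2 <;> simp [h1, h2, h0]

theorem IsGradedFrobenius.eq_zero_of_forall_form (h : IsGradedFrobenius 𝒜 L)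
    {ω : Module.Dual k A} (hω' : ∀ a ∈ 𝒜 L, ω a = 0 → a = 0) {n : ℕ} (hn : n ≤ L)
    {a : A} (ha : a ∈ 𝒜 n)
    (h0 : ∀ b ∈ 𝒜 (L - n), ω (b * a) = 0) : a = 0 := by
  by_contra hne
  obtain ⟨b, hb, hba⟩ := h.exists_mul_ne_zero n hn a ha hne
  refine hba (hω' _ ?_ (h0 b hb))
  have := SetLike.GradedMul.mul_mem hb ha
  rwa [Nat.sub_add_cancel hn] at this

/-- The bilinear form `(a, b) ↦ ω (b a)`. -/
def formMul (ω : Module.Dual k A) : A →ₗ[k] Module.Dual k A :=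
  ((LinearMap.mul k A).compr₂ ω).flip

theorem formMul_apply (ω : Module.Dual k A) (a b : A) : formMul ω a b = ω (b * a) := rfl

theorem IsGradedFrobenius.formMul_injective (h : IsGradedFrobenius 𝒜 L)
    {ω : Module.Dual k A} (hω : ∀ n, n ≠ L → ∀ a ∈ 𝒜 n, ω a = 0)
    (hω' : ∀ a ∈ 𝒜 L, ω a = 0 → a = 0) : Function.Injective (formMul ω) := by
  rw [← LinearMap.ker_eq_bot, LinearMap.ker_eq_bot']
  intro a ha
  have h0 : ∀ n ∈ Finset.range (L + 1), layerProj 𝒜 n a = 0 := by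
    intro n hn
    have hn' : n ≤ L := Nat.lt_succ_iff.1 (Finset.mem_range.1 hn)
    refine h.eq_zero_of_forall_form hω' hn' (layerProj_mem 𝒜 n a) fun b _ => ?_
    have h1 := form_layerProj_mul hω (Nat.sub_le L n) b a
    rw [Nat.sub_sub_self hn'] at h1
    rw [← h1, ← formMul_apply, ha, LinearMap.zero_apply]
  have := LinearMap.congr_fun (sum_layerProj 𝒜 h.eq_bot) a
  rw [LinearMap.sum_apply, Finset.sum_eq_zero h0] at this
  exact this.symm

/-- `Q` does not decrease degrees. -/
def IsFiltered (𝒜 : ℕ → Submodule k A) [GradedAlgebra 𝒜] (Q : A ≃ₐ[k] A) : Prop :=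
  ∀ n, ∀ a ∈ 𝒜 n, Q a ∈ upperLayers 𝒜 n

/-- A degree-one element is nilpotent, so the degree-zero component of its image is a nilpotent
scalar, that is, zero. Generation in degree one and multiplicativity of the filtration do the rest.
-/
theorem isFiltered_of_generated [Nontrivial A] (h : IsGradedFrobenius 𝒜 L)
    (h0 : 𝒜 0 = 1) (h1 : ∀ n, 𝒜 (n + 1) ≤ 𝒜 n * 𝒜 1) (Q : A ≃ₐ[k] A) : IsFiltered 𝒜 Q := by
  have hQ1 : ∀ a ∈ 𝒜 1, Q a ∈ upperLayers 𝒜 1 := by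
    intro a ha
    rw [mem_upperLayers]
    intro i hi
    obtain rfl : i = 0 := by omega
    have hnil : a ^ (L + 1) = 0 := by
      have := SetLike.pow_mem_graded (L + 1) ha
      rwa [h.eq_bot _ (by simp), Submodule.mem_bot] at this
    have h2 : GradedRing.projZeroRingHom 𝒜 (Q a) ^ (L + 1) = 0 := by
      rw [← map_pow, ← map_pow, hnil, map_zero, map_zero]
    change GradedRing.projZeroRingHom 𝒜 (Q a) = 0
    have h3 : GradedRing.projZeroRingHom 𝒜 (Q a) ∈ 𝒜 0 := layerProj_mem 𝒜 0 (Q a)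
    rw [h0] at h3
    obtain ⟨c, hc⟩ := Submodule.mem_one.1 h3
    rw [← hc, ← map_pow, map_eq_zero] at h2
    rw [← hc, eq_zero_of_pow_eq_zero h2, map_zero]
  intro n
  induction n with
  | zero => exact fun a _ => (mem_upperLayers 𝒜).2 fun i hi => absurd hi (Nat.not_lt_zero i)
  | succ n ih =>
    intro a ha
    have ha' := h1 n ha
    clear ha
    induction ha' using Submodule.mul_induction_on' with
    | mem_mul_mem x hx y hy =>
      rw [map_mul]
      exact mul_mem_upperLayers 𝒜 (ih x hx) (hQ1 y hy)
    | add x _ y _ hx hy => rw [map_add]; exact add_mem hx hy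

variable [FiniteDimensional k A]

/-- The pairing embeds `𝒜 n` into the dual of `𝒜 (L - n)`. The trace of the identity would give the
dimensions only as elements of `k`, which loses information in positive characteristic. -/
theorem IsGradedFrobenius.finrank_le (h : IsGradedFrobenius 𝒜 L) {n : ℕ} (hn : n ≤ L) :
    Module.finrank k (𝒜 n) ≤ Module.finrank k (𝒜 (L - n)) := by
  obtain ⟨ω, hω, hω'⟩ := h.exists_form
  let φ : 𝒜 n →ₗ[k] Module.Dual k (𝒜 (L - n)) :=
    Module.Dual.transpose (𝒜 (L - n)).subtype ∘ₗ formMul ω ∘ₗ (𝒜 n).subtype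
  have hφ : Function.Injective φ := by
    rw [← LinearMap.ker_eq_bot, LinearMap.ker_eq_bot']
    intro a ha
    exact Subtype.ext (h.eq_zero_of_forall_form hω' hn a.2 fun b hb =>
      LinearMap.congr_fun ha ⟨b, hb⟩)
  rw [← Subspace.dual_finrank_eq (K := k) (V := 𝒜 (L - n))]
  exact LinearMap.finrank_le_finrank_of_injective hφ

/-- Operators adjoint up to a scalar for a nondegenerate bilinear form have the same trace up to
that scalar. -/
theorem trace_eq_of_formMul_injective {ω : Module.Dual k A}
    (hω : Function.Injective (formMul ω)) {c : k} {S T : A →ₗ[k] A}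
    (h : ∀ a b, ω (S a * b) = c * ω (a * T b)) :
    LinearMap.trace k A S = c * LinearMap.trace k A T := by
  let e : A ≃ₗ[k] Module.Dual k A :=
    LinearEquiv.ofInjectiveOfFinrankEq (formMul ω) hω Subspace.dual_finrank_eq.symm
  -- Under the identification of `A` with its dual given by the form, the transpose of `S` becomes
  -- `c • T`.
  have h1 : Module.Dual.transpose S = e.conj (c • T) := by
    ext φ a
    obtain ⟨b, rfl⟩ := e.surjective φ
    rw [LinearEquiv.conj_apply_apply, LinearEquiv.symm_apply_apply, LinearMap.smul_apply, map_smul]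
    exact h a b
  rw [← LinearMap.trace_transpose' S, h1, LinearMap.trace_conj', map_smul, smul_eq_mul]

theorem IsGradedFrobenius.trace_layerProj_comp (h : IsGradedFrobenius 𝒜 L) {Q : A ≃ₐ[k] A}
    (hQ : IsFiltered 𝒜 Q.symm) {Λ : A} (hΛ : Λ ∈ 𝒜 L) (hΛ0 : Λ ≠ 0) {c : k}
    (hc : Q Λ = c • Λ) {n : ℕ} (hn : n ≤ L) :
    LinearMap.trace k A (layerProj 𝒜 n ∘ₗ Q.toLinearMap) =
      c * LinearMap.trace k A (layerProj 𝒜 (L - n) ∘ₗ Q.symm.toLinearMap) := by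
  -- The adjointness below concerns the compressions `P S P`; they have the same trace as `P S` by
  -- cyclicity and `P² = P`.
  have hcyc : ∀ (m : ℕ) (S : A →ₗ[k] A), LinearMap.trace k A (layerProj 𝒜 m ∘ₗ S) =
      LinearMap.trace k A (layerProj 𝒜 m ∘ₗ S ∘ₗ layerProj 𝒜 m) := by
    intro m S
    conv_lhs => rw [← layerProj_comp_self, LinearMap.comp_assoc, LinearMap.trace_comp_comm']
    rw [LinearMap.comp_assoc]
  obtain ⟨ω, hω, hω'⟩ := h.exists_form
  rw [hcyc n, hcyc (L - n)]
  refine trace_eq_of_formMul_injective (h.formMul_injective hω hω') fun a b => ?_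
  -- As `Q⁻¹` does not lower degrees, this product has no component below degree `L`, so it lies on
  -- the line scaled by `Q`.
  have hz : layerProj 𝒜 n a * Q.symm (layerProj 𝒜 (L - n) b) ∈ 𝒜 L := by
    apply upperLayers_le_top h
    have := mul_mem_upperLayers 𝒜 (mem_upperLayers_of_mem 𝒜 le_rfl (layerProj_mem 𝒜 n a))
      (hQ _ _ (layerProj_mem 𝒜 (L - n) b))
    rwa [Nat.add_sub_cancel' hn] at this
  have hQz : Q (layerProj 𝒜 n a * Q.symm (layerProj 𝒜 (L - n) b)) =
      c • (layerProj 𝒜 n a * Q.symm (layerProj 𝒜 (L - n) b)) := by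
    obtain ⟨d, hd⟩ := (finrank_eq_one_iff_of_nonzero' (⟨Λ, hΛ⟩ : 𝒜 L)
      (fun h => hΛ0 (congrArg Subtype.val h))).1 h.finrank_top ⟨_, hz⟩
    have hd' := congrArg Subtype.val hd
    simp only [Submodule.coe_smul] at hd'
    rw [← hd', map_smul, hc, smul_comm]
  change ω (layerProj 𝒜 n (Q (layerProj 𝒜 n a)) * b) =
    c * ω (a * layerProj 𝒜 (L - n) (Q.symm (layerProj 𝒜 (L - n) b)))
  rw [form_layerProj_mul hω hn (Q _), ← form_layerProj_mul hω hn a]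
  have h1 := congrArg ω hQz
  rwa [map_mul, AlgEquiv.apply_symm_apply, map_smul, smul_eq_mul] at h1

/-- For `n < L`, adjointness moves the projection in a pairing with `P_n Λ` onto the other factor,
which then has positive degree `L - n` and annihilates `Λ`. So `P_n Λ` is orthogonal to everything.
-/
theorem IsGradedFrobenius.mem_top_of_mul_eq_zero (h : IsGradedFrobenius 𝒜 L) {Λ : A}
    (hΛ : (∀ m, m ≠ 0 → ∀ x ∈ 𝒜 m, x * Λ = 0) ∨ (∀ m, m ≠ 0 → ∀ x ∈ 𝒜 m, Λ * x = 0)) :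
    Λ ∈ 𝒜 L := by
  obtain ⟨ω, hω, hω'⟩ := h.exists_form
  apply upperLayers_le_top h
  rw [mem_upperLayers]
  intro n hn
  rcases hΛ with hΛ | hΛ
  · refine h.eq_zero_of_forall_form hω' hn.le (layerProj_mem 𝒜 n Λ) fun b hb => ?_
    have h1 := form_layerProj_mul hω (Nat.sub_le L n) b Λ
    rw [Nat.sub_sub_self hn.le] at h1
    rw [← h1, layerProj_of_mem 𝒜 hb, hΛ _ (by omega) b hb, map_zero]
  -- Here `P_n Λ` is the left factor of the pairing; in finite dimension an injective `formMul ω` is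
  -- surjective, so nondegeneracy holds on this side too.
  · have hinj := h.formMul_injective hω hω'
    have hsurj : Function.Surjective (formMul ω) :=
      (LinearMap.injective_iff_surjective_of_finrank_eq_finrank
        Subspace.dual_finrank_eq.symm).1 hinj
    rw [← Module.forall_dual_apply_eq_zero_iff k]
    intro φ
    obtain ⟨b, rfl⟩ := hsurj φ
    rw [formMul_apply, form_layerProj_mul hω hn.le, hΛ (L - n) (by omega) _ (layerProj_mem _ _ _),
      map_zero]

theorem IsGradedFrobenius.trace_eq (h : IsGradedFrobenius 𝒜 L) {Q : A ≃ₐ[k] A}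
    (hQ : IsFiltered 𝒜 Q.symm) {Λ : A} (hΛ : Λ ∈ 𝒜 L) (hΛ0 : Λ ≠ 0) {c : k}
    (hc : Q Λ = c • Λ) :
    LinearMap.trace k A Q.toLinearMap = c * LinearMap.trace k A Q.symm.toLinearMap := by
  have hsum : ∀ S : A →ₗ[k] A, LinearMap.trace k A S =
      ∑ n ∈ Finset.range (L + 1), LinearMap.trace k A (layerProj 𝒜 n ∘ₗ S) := by
    intro S
    have : ∑ n ∈ Finset.range (L + 1), layerProj 𝒜 n ∘ₗ S = S := by
      ext x
      simpa using LinearMap.congr_fun (sum_layerProj 𝒜 h.eq_bot) (S x)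
    rw [← map_sum, this]
  rw [hsum, hsum, ← Finset.sum_range_reflect, Finset.mul_sum]
  refine Finset.sum_congr rfl fun n hn => ?_
  have hn' : n ≤ L := Nat.lt_succ_iff.1 (Finset.mem_range.1 hn)
  rw [show L + 1 - 1 - n = L - n by omega,
    h.trace_layerProj_comp hQ hΛ hΛ0 hc (Nat.sub_le L n), Nat.sub_sub_self hn']

theorem IsGradedFrobenius.gradedTrace_eq (h : IsGradedFrobenius 𝒜 L) {Q : A ≃ₐ[k] A}
    (hQ : IsFiltered 𝒜 Q.symm) {Λ : A} (hΛ : Λ ∈ 𝒜 L) (hΛ0 : Λ ≠ 0) {c : k}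
    (hc : Q Λ = c • Λ) :
    (gradedTrace 𝒜 Q.toLinearMap).toLaurent =
      LaurentPolynomial.C c * LaurentPolynomial.T (L : ℤ) *
        LaurentPolynomial.invert (gradedTrace 𝒜 Q.symm.toLinearMap).toLaurent := by
  have h0 : ∀ (S : A →ₗ[k] A) n, L < n → (gradedTrace 𝒜 S).coeff n = 0 := fun S n hn => by
    rw [coeff_gradedTrace, layerProj_eq_zero 𝒜 (h.eq_bot n hn), LinearMap.zero_comp, map_zero]
  refine Polynomial.toLaurent_eq_of_coeff_eq (h0 _) (h0 _) fun n hn => ?_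
  rw [coeff_gradedTrace, coeff_gradedTrace, h.trace_layerProj_comp hQ hΛ hΛ0 hc hn]

theorem IsGradedFrobenius.hilbertPoly_eq (h : IsGradedFrobenius 𝒜 L) :
    (hilbertPoly 𝒜).toLaurent = LaurentPolynomial.T (L : ℤ) *
      LaurentPolynomial.invert (hilbertPoly 𝒜).toLaurent := by
  have h0 : ∀ n, L < n → (hilbertPoly 𝒜).coeff n = 0 := fun n hn => by
    rw [coeff_hilbertPoly, h.eq_bot n hn, finrank_bot, Nat.cast_zero]
  have := Polynomial.toLaurent_eq_of_coeff_eq (c := 1) h0 h0 fun n hn => by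
    have h1 := h.finrank_le (Nat.sub_le L n)
    rw [Nat.sub_sub_self hn] at h1
    rw [coeff_hilbertPoly, coeff_hilbertPoly, one_mul, le_antisymm (h.finrank_le hn) h1]
  rwa [map_one, one_mul] at this

end GradedFrobenius

/-! ### The Nichols algebra as a graded Frobenius algebra -/

namespace YetterDrinfeldModule

variable {k G M : Type*} [Field k] [Group G] [AddCommGroup M] [Module k M]

theorem nicholsLayer_zero (D : YetterDrinfeldModule k G M) : D.nicholsLayer 0 = 1 := by
  rw [nicholsLayer, tensorLayer, pow_zero, Submodule.map_one]

theorem nicholsLayer_succ (D : YetterDrinfeldModule k G M) (n : ℕ) :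
    D.nicholsLayer (n + 1) = D.nicholsLayer n * D.nicholsLayer 1 := by
  rw [nicholsLayer, nicholsLayer, nicholsLayer, ← Submodule.map_mul, tensorLayer, pow_succ,
    tensorLayer, tensorLayer, pow_one]

theorem ι_mem_tensorLayer (v : M) : TensorAlgebra.ι k v ∈ tensorLayer k M 1 := by
  rw [tensorLayer, pow_one]
  exact ⟨v, rfl⟩

/-- Were `b` annihilated by `M`, `exists_sub_smul_mem` would force every layer above degree `n` to
vanish, including the layer `L`. -/
theorem exists_ι_mul_ne_zero (D : YetterDrinfeldModule k G M) {L n : ℕ}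
    (hL : D.nicholsLayer L ≠ ⊥) (hn : n < L) {b : D.NicholsAlgebra} (hb : b ∈ D.nicholsLayer n)
    (hb0 : b ≠ 0) : ∃ x ∈ D.nicholsLayer 1, x * b ≠ 0 := by
  obtain ⟨b, hb, rfl⟩ := hb
  by_contra! h
  apply hL
  rw [eq_bot_iff]
  rintro _ ⟨a, ha, rfl⟩
  obtain ⟨c, hc, hc0⟩ := D.exists_sub_smul_mem hb
    (fun h => hb0 (Ideal.Quotient.eq_zero_iff_mem.2 h)) (fun v => Ideal.Quotient.eq_zero_iff_mem.1
      (h _ (Submodule.mem_map_of_mem (ι_mem_tensorLayer v)))) hn.le ha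
  rw [hc0 hn.ne', zero_smul, sub_zero] at hc
  exact (Submodule.mem_bot k).2 (Ideal.Quotient.eq_zero_iff_mem.2 hc)

theorem exists_eq_smul_of_mem_top (D : YetterDrinfeldModule k G M) {L : ℕ}
    (hL : D.nicholsLayer (L + 1) = ⊥) {a b : D.NicholsAlgebra} (ha : a ∈ D.nicholsLayer L)
    (hb : b ∈ D.nicholsLayer L) (hb0 : b ≠ 0) : ∃ c : k, c • b = a := by
  obtain ⟨a, ha, rfl⟩ := ha
  obtain ⟨b, hb, rfl⟩ := hb
  obtain ⟨c, hc, -⟩ := D.exists_sub_smul_mem hb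
    (fun h => hb0 (Ideal.Quotient.eq_zero_iff_mem.2 h)) (fun v => by
      have h1 : D.nicholsMk (TensorAlgebra.ι k v * b) ∈ D.nicholsLayer (1 + L) :=
        Submodule.mem_map_of_mem (SetLike.GradedMul.mul_mem (ι_mem_tensorLayer v) hb)
      rw [add_comm, hL, Submodule.mem_bot] at h1
      exact Ideal.Quotient.eq_zero_iff_mem.1 h1) le_rfl ha
  refine ⟨c, ?_⟩
  have h1 : D.nicholsMk (a - c • b) = 0 := Ideal.Quotient.eq_zero_iff_mem.2 hc
  rw [map_sub, map_smul, sub_eq_zero] at h1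
  exact h1.symm

/-- A nonzero element below the top degree can be multiplied from the left by some element of degree
one without becoming zero; repeating this reaches degree `L`. -/
theorem IsTopDegree.isGradedFrobenius {D : YetterDrinfeldModule k G M} {L : ℕ}
    (hL : D.IsTopDegree L) : IsGradedFrobenius D.nicholsLayer L := by
  have hbot : ∀ n, L < n → D.nicholsLayer n = ⊥ := fun n hn => by
    by_contra h
    exact absurd (hL.2 h) (not_le.2 hn)
  refine ⟨hbot, ?_, ?_⟩
  · obtain ⟨b, hb, hb0⟩ := Submodule.exists_mem_ne_zero_of_ne_bot hL.1
    refine finrank_eq_one (⟨b, hb⟩ : D.nicholsLayer L) (fun h => hb0 (congrArg Subtype.val h)) ?_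
    intro a
    obtain ⟨c, hc⟩ := D.exists_eq_smul_of_mem_top (hbot _ (Nat.lt_succ_self L)) a.2 hb hb0
    exact ⟨c, Subtype.ext hc⟩
  · intro n hn
    induction hn using Nat.decreasingInduction with
    | self =>
      intro a _ ha0
      refine ⟨1, ?_, by rwa [one_mul]⟩
      rw [Nat.sub_self]
      exact SetLike.GradedOne.one_mem
    | @of_succ n hn ih =>
      intro a ha ha0
      obtain ⟨x, hx, hxa⟩ := D.exists_ι_mul_ne_zero hL.1 hn ha ha0
      have hxa' := SetLike.GradedMul.mul_mem hx ha
      rw [add_comm 1 n] at hxa'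
      obtain ⟨b, hb, hba⟩ := ih _ hxa' hxa
      refine ⟨b * x, ?_, by rwa [mul_assoc]⟩
      have := SetLike.GradedMul.mul_mem hb hx
      rwa [show L - (n + 1) + 1 = L - n by omega] at this

theorem counit_of_mem (D : YetterDrinfeldModule k G M) {n : ℕ} (hn : n ≠ 0)
    {x : D.NicholsAlgebra} (hx : x ∈ D.nicholsLayer n) : D.counit x = 0 := by
  obtain ⟨a, ha, rfl⟩ := hx
  change TensorAlgebra.algebraMapInv a = 0
  apply (TensorAlgebra.algebraMap_leftInverse (R := k) M).injective
  rw [map_zero, ← proj_zero_eq, proj_of_mem_ne ha hn]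

theorem IsIntegral.mem_top {D : YetterDrinfeldModule k G M} [FiniteDimensional k D.NicholsAlgebra]
    {L : ℕ} (hL : D.IsTopDegree L) {Λ : D.NicholsAlgebra} (hΛ : D.IsIntegral Λ) :
    Λ ∈ D.nicholsLayer L := by
  refine hL.isGradedFrobenius.mem_top_of_mul_eq_zero ?_
  refine hΛ.2.imp (fun h m hm x hx => ?_) (fun h m hm x hx => ?_) <;>
  rw [h, D.counit_of_mem hm hx, zero_smul]

end YetterDrinfeldModule

theorem mainTheorem2 {k G M : Type*} [Field k] [Group G] [AddCommGroup M] [Module k M]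
    (D : YetterDrinfeldModule k G M) [FiniteDimensional k D.NicholsAlgebra]
    (L : ℕ) (hL : D.IsTopDegree L) (Λ : D.NicholsAlgebra) (hΛ : D.IsIntegral Λ) :
    (∀ Q : D.NicholsAlgebra ≃ₐ[k] D.NicholsAlgebra,
      (∃! lam : kˣ, Q Λ = (lam : k) • Λ) ∧
      ∀ lam : kˣ, Q Λ = (lam : k) • Λ →
        LinearMap.trace k D.NicholsAlgebra Q.toLinearMap =
          (lam : k) * LinearMap.trace k D.NicholsAlgebra Q.symm.toLinearMap ∧
        (gradedTrace D.nicholsLayer Q.toLinearMap).toLaurent =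
          LaurentPolynomial.C (lam : k) * LaurentPolynomial.T (L : ℤ) *
            LaurentPolynomial.invert
              (gradedTrace D.nicholsLayer Q.symm.toLinearMap).toLaurent) ∧
    (hilbertPoly D.nicholsLayer).toLaurent =
      LaurentPolynomial.T (L : ℤ) *
        LaurentPolynomial.invert (hilbertPoly D.nicholsLayer).toLaurent := by
  have hF := hL.isGradedFrobenius
  have hΛL := hΛ.mem_top hL
  have : Nontrivial D.NicholsAlgebra := ⟨Λ, 0, hΛ.1⟩
  have hfil := isFiltered_of_generated hF D.nicholsLayer_zero fun n => (D.nicholsLayer_succ n).le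
  refine ⟨fun Q => ⟨?_, fun lam hlam => ⟨hF.trace_eq (hfil _) hΛL hΛ.1 hlam,
    hF.gradedTrace_eq (hfil _) hΛL hΛ.1 hlam⟩⟩, hF.hilbertPoly_eq⟩
  -- Since `Q` does not lower degrees, `Q Λ` stays in the top layer, which is spanned by `Λ`.
  obtain ⟨c, hc⟩ := D.exists_eq_smul_of_mem_top (hF.eq_bot _ (Nat.lt_succ_self L))
    (upperLayers_le_top hF (hfil Q L Λ hΛL)) hΛL hΛ.1
  have hc0 : c ≠ 0 := by
    rintro rfl
    rw [zero_smul] at hc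
    exact hΛ.1 ((map_eq_zero_iff Q Q.injective).1 hc.symm)
  refine ⟨Units.mk0 c hc0, hc.symm, fun d hd => Units.ext ?_⟩
  exact smul_left_injective k hΛ.1 (hd.symm.trans hc.symm)
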